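/- Let $\mathbb D=\{z\in\mathbb C:|z|<1\}$. Let $\mathscr A$ be the class of analytic functions $f$ in $\mathbb D$ with $f(0)=0$ and $f'(0)=1$, and let $\mathscr P_e$ be the class of analytic functions $p$ in $\mathbb D$ with $p(0)=1$ that are subordinate to the exponential function, that is, $p=e^{w}$ in $\mathbb D$ for some analytic $w:\mathbb D\to\mathbb D$ with $w(0)=0$. A function $f\in\mathscr A$ is called exponential convex if $1+zf''(z)/f'(z)$ belongs to $\mathscr P_e$, and exponential starlike if $zf'(z)/f(z)$ (extended by the value $1$ at $z=0$) belongs to $\mathscr P_e$. For $\mu,\nu$ such that neither $\mu+\nu$ nor $\mu-\nu$ is a negative odd integer, let $$s_{\mu,\nu}(z)=\frac{z^{\mu+1}}{(\mu-\nu+1)(\mu+\nu+1)}\;{}_1F_2\!\left(1;\tfrac{\mu-\nu+3}{2},\tfrac{\mu+\nu+3}{2};-\tfrac{z^2}{4}\right)$$ be the Lommel function of the first kind, let $$h_{\mu,\nu}(z)=(\mu-\nu+1)(\mu+\nu+1)\,z^{(1-\mu)/2}s_{\mu,\nu}(\sqrt z)=z+\sum_{n\ge1}\frac{(-1/4)^n}{\left(\frac{\mu-\nu+3}{2}\right)_n\left(\frac{\mu+\nu+3}{2}\right)_n}z^{n+1}\qquad(z\in\mathbb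 D)$$ be its normalization, where $(x)_n=x(x+1)\cdots(x+n-1)$, and let $f_{\mu,\nu}(z)=\int_0^z \frac{h_{\mu,\nu}(t)}{t}\,dt$ be the Alexander transform of $h_{\mu,\nu}$. **Theorem.** Let $\mu,\nu\in\mathbb R$ be such that neither $\mu+\nu$ nor $\mu-\nu$ is a negative odd integer, $$(\mu+1)\big((\mu+1)(\mu+3)-\nu^2\big)\ge\tfrac18$$ and $$\mu(2e-1)-\tfrac14e(e-1)\left|(\mu-1)^2-\nu^2\right|\ge e^3-e^2+\tfrac{13e}{4}-4 .$$ Then $f_{\mu,\nu}$ is exponential convex, and hence $h_{\mu,\nu}$ is exponential starlike. -/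

import Mathlib

namespace LommelExp

noncomputable section

/-- The open unit disk in `ℂ`. -/
def unitDisk : Set ℂ := Metric.ball 0 1

/-- `f ≺ g` in the unit disk: `f = g ∘ w` there, for some analytic `w` with `w 0 = 0` that maps
the disk into itself. -/
def Subordinate (f g : ℂ → ℂ) : Prop :=
  ∃ w : ℂ → ℂ, AnalyticOnNhd ℂ w unitDisk ∧ w 0 = 0 ∧
    (∀ z ∈ unitDisk, ‖w z‖ < 1) ∧ ∀ z ∈ unitDisk, f z = g (w z)

/-- The family `𝒫ₑ`: analytic functions `p` in the disk with `p 0 = 1` and `p ≺ exp`. -/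
def ClassPe (p : ℂ → ℂ) : Prop :=
  AnalyticOnNhd ℂ p unitDisk ∧ p 0 = 1 ∧ Subordinate p Complex.exp

/-- The class `𝒜` of analytic functions in the disk with `f 0 = f' 0 - 1 = 0`. -/
def ClassA (f : ℂ → ℂ) : Prop :=
  AnalyticOnNhd ℂ f unitDisk ∧ f 0 = 0 ∧ deriv f 0 = 1

/-- `f` is exponential convex: `f ∈ 𝒜` and `1 + z f''(z) / f'(z)` is (well defined and) in `𝒫ₑ`. -/
def ExpConvex (f : ℂ → ℂ) : Prop :=
  ClassA f ∧ (∀ z ∈ unitDisk, deriv f z ≠ 0) ∧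
    ClassPe (fun z => 1 + z * deriv (deriv f) z / deriv f z)

/-- `f` is exponential starlike: `f ∈ 𝒜` and `z f'(z) / f(z)` is in `𝒫ₑ`. The quotient has a
removable singularity at the origin, so membership in `𝒫ₑ` is asked of an extension `p`. -/
def ExpStarlike (f : ℂ → ℂ) : Prop :=
  ClassA f ∧ (∀ z ∈ unitDisk, z ≠ 0 → f z ≠ 0) ∧
    ∃ p : ℂ → ℂ, ClassPe p ∧ ∀ z ∈ unitDisk, z ≠ 0 → p z = z * deriv f z / f z

/-- The Pochhammer symbol `(x)ₙ = x (x + 1) ⋯ (x + n - 1)`. -/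
def pochhammer (x : ℂ) (n : ℕ) : ℂ := (ascPochhammer ℂ n).eval x

/-- The hypergeometric function `₁F₂(a; b, c; z)`, for `b, c ∉ {0, -1, -2, …}`. -/
def hyp1F2 (a b c z : ℂ) : ℂ :=
  ∑' n : ℕ, pochhammer a n / (pochhammer b n * pochhammer c n) * (z ^ n / (n.factorial : ℂ))

/-- The Lommel function of the first kind `s_{μ,ν}`, where neither of `μ ± ν` is a negative odd
integer (powers are principal values). -/
def lommelS (μ ν z : ℂ) : ℂ :=
  z ^ (μ + 1) / ((μ - ν + 1) * (μ + ν + 1)) *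
    hyp1F2 1 ((μ - ν + 3) / 2) ((μ + ν + 3) / 2) (-(z ^ 2) / 4)

/-- The normalized Lommel function
`h_{μ,ν}(z) = (μ - ν + 1) (μ + ν + 1) z ^ ((1 - μ) / 2) s_{μ,ν}(√z)`. -/
def lommelH (μ ν z : ℂ) : ℂ :=
  (μ - ν + 1) * (μ + ν + 1) * z ^ ((1 - μ) / 2) * lommelS μ ν (z ^ (1 / 2 : ℂ))

/-- The Alexander transform `∫₀ᶻ f(t) / t dt`, the integral being taken along the segment
`t = s z`, `0 ≤ s ≤ 1`. -/
def alexander (f : ℂ → ℂ) (z : ℂ) : ℂ :=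
  ∫ s in (0 : ℝ)..1, f (s * z) / (s * z) * z

end

end LommelExp

namespace LommelExp

open Metric

theorem ClassPe.congr {p q : ℂ → ℂ} (hp : ClassPe p) (h : ∀ z ∈ unitDisk, p z = q z) :
    ClassPe q := by
  obtain ⟨ha, h0, w, hw, hw0, hlt, heq⟩ := hp
  refine ⟨ha.congr isOpen_ball h, ?_, w, hw, hw0, hlt, fun z hz => (h z hz).symm.trans (heq z hz)⟩
  rw [← h 0 (mem_ball_self one_pos), h0]

/-- The logarithm of `1 + u` is a Schwarz function as soon as `‖u‖ ≤ 1 / 2` and `u 0 = 0`. -/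
theorem classPe_one_add {u : ℂ → ℂ} (hu : AnalyticOnNhd ℂ u unitDisk) (h0 : u 0 = 0)
    (hle : ∀ z ∈ unitDisk, ‖u z‖ ≤ 1 / 2) : ClassPe (fun z => 1 + u z) := by
  have hslit : ∀ z ∈ unitDisk, 1 + u z ∈ Complex.slitPlane := fun z hz =>
    Complex.mem_slitPlane_of_norm_lt_one ((hle z hz).trans_lt (by norm_num))
  have ha : AnalyticOnNhd ℂ (fun z => 1 + u z) unitDisk := fun z hz =>
    analyticAt_const.add (hu z hz)
  refine ⟨ha, by simp [h0], fun z => Complex.log (1 + u z), fun z hz => (ha z hz).clog (hslit z hz),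
    by simp [h0], fun z hz => ?_,
    fun z hz => (Complex.exp_log (Complex.slitPlane_ne_zero (hslit z hz))).symm⟩
  have := Complex.norm_log_one_add_half_le_self (hle z hz)
  linarith [hle z hz]

theorem unitDisk_subset_ball_two : unitDisk ⊆ ball (0 : ℂ) 2 := ball_subset_ball one_le_two

theorem ne_zero_of_norm_sub_one_le {w : ℂ} (h : ‖w - 1‖ ≤ 1 / 9) : 8 / 9 ≤ ‖w‖ ∧ w ≠ 0 := by
  have h1 : 8 / 9 ≤ ‖w‖ := by
    have := norm_sub_norm_le (1 : ℂ) w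
    rw [norm_one, norm_sub_rev] at this
    linarith
  exact ⟨h1, norm_pos_iff.1 (by linarith)⟩

theorem classPe_logDeriv {G : ℂ → ℂ} (hG : DifferentiableOn ℂ G (ball 0 2))
    (hb : ∀ z ∈ ball (0 : ℂ) 2, ‖G z - 1‖ ≤ 1 / 9) :
    ClassPe (fun z => 1 + z * deriv G z / G z) := by
  have hGa : AnalyticOnNhd ℂ G (ball 0 2) := hG.analyticOnNhd isOpen_ball
  refine classPe_one_add (u := fun z => z * deriv G z / G z) (fun z hz => ?_) (by simp)
    fun z hz => ?_
  · have hz2 := unitDisk_subset_ball_two hz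
    exact (analyticAt_id.mul (hGa z hz2).deriv).div (hGa z hz2)
      (ne_zero_of_norm_sub_one_le (hb z hz2)).2
  · have hz2 := unitDisk_subset_ball_two hz
    have hz1 : ‖z‖ < 1 := by simpa [unitDisk] using hz
    have hsub : closedBall z 1 ⊆ ball (0 : ℂ) 2 := fun w hw => by
      rw [mem_closedBall, dist_eq_norm] at hw
      rw [mem_ball_zero_iff]
      have := norm_add_le (w - z) z
      rw [sub_add_cancel] at this
      linarith
    have hd : DiffContOnCl ℂ (fun w => G w - 1) (ball z 1) := by
      refine DifferentiableOn.diffContOnCl ((hG.sub_const 1).mono ?_)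
      exact closure_ball_subset_closedBall.trans hsub
    have hder := Complex.norm_deriv_le_of_forall_mem_sphere_norm_le one_pos hd
      fun w hw => hb w (hsub (sphere_subset_closedBall hw))
    rw [deriv_sub_const, div_one] at hder
    have hlow := (ne_zero_of_norm_sub_one_le (hb z hz2)).1
    rw [norm_div, norm_mul, div_le_iff₀ (by linarith)]
    nlinarith [norm_nonneg z, norm_nonneg (deriv G z)]

theorem expStarlike_of_eq_mul {G h : ℂ → ℂ} (hG : DifferentiableOn ℂ G (ball 0 2))
    (hb : ∀ z ∈ ball (0 : ℂ) 2, ‖G z - 1‖ ≤ 1 / 9) (hG0 : G 0 = 1) (hh : ∀ z, h z = z * G z) :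
    ExpStarlike h := by
  have hGa : AnalyticOnNhd ℂ G (ball 0 2) := hG.analyticOnNhd isOpen_ball
  obtain rfl : h = fun z => z * G z := funext hh
  have hd : ∀ z ∈ unitDisk, deriv (fun z => z * G z) z = G z + z * deriv G z := fun z hz => by
    simpa using ((hasDerivAt_id' z).fun_mul
      (hGa z (unitDisk_subset_ball_two hz)).differentiableAt.hasDerivAt).deriv
  have hne : ∀ z ∈ unitDisk, G z ≠ 0 := fun z hz =>
    (ne_zero_of_norm_sub_one_le (hb z (unitDisk_subset_ball_two hz))).2
  refine ⟨⟨fun z hz => analyticAt_id.mul (hGa z (unitDisk_subset_ball_two hz)), by simp, ?_⟩,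
    fun z hz hz0 => mul_ne_zero hz0 (hne z hz), _, classPe_logDeriv hG hb, fun z hz hz0 => ?_⟩
  · rw [hd 0 (mem_ball_self one_pos)]
    simp [hG0]
  · have := hne z hz
    rw [hd z hz]
    field_simp

theorem hasDerivAt_alexander {G h : ℂ → ℂ} {r : ℝ} (hG : DifferentiableOn ℂ G (ball 0 r))
    (hh : ∀ z, h z = z * G z) {z : ℂ} (hz : z ∈ ball 0 r) :
    HasDerivAt (alexander h) (G z) z := by
  obtain ⟨F, hF0, hF⟩ := hG.isExactOn_ball.with_val_at 0 0
  suffices heq : ∀ w ∈ ball (0 : ℂ) r, alexander h w = F w from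
    (hF z hz).congr_of_eventuallyEq
      (Filter.eventually_of_mem (isOpen_ball.mem_nhds hz) heq)
  intro w hw
  have hmem : ∀ s ∈ Set.uIcc (0 : ℝ) 1, (s : ℂ) * w ∈ ball (0 : ℂ) r := fun s hs => by
    rw [Set.uIcc_of_le zero_le_one] at hs
    rw [mem_ball_zero_iff] at hw ⊢
    rw [norm_mul, Complex.norm_real, Real.norm_of_nonneg hs.1]
    exact (mul_le_of_le_one_left (norm_nonneg w) hs.2).trans_lt hw
  have hint : ∫ s in (0 : ℝ)..1, G (s * w) * w = F w := by
    have hder : ∀ s ∈ Set.uIcc (0 : ℝ) 1,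
        HasDerivAt (fun s : ℝ => F (s * w)) (G (s * w) * w) s := fun s hs => by
      have h1 : HasDerivAt (fun s : ℝ => (s : ℂ) * w) w s := by
        simpa using (Complex.ofRealCLM.hasDerivAt (x := s)).mul_const w
      exact (hF _ (hmem s hs)).comp s h1
    have hcont : ContinuousOn (fun s : ℝ => G (s * w) * w) (Set.uIcc 0 1) :=
      (hG.continuousOn.comp (by fun_prop) hmem).mul continuousOn_const
    rw [intervalIntegral.integral_eq_sub_of_hasDerivAt hder hcont.intervalIntegrable]
    simp [hF0]
  rw [← hint, alexander]
  refine intervalIntegral.integral_congr_uIoo fun s hs => ?_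
  rw [Set.uIoo_of_le zero_le_one] at hs
  rcases eq_or_ne w 0 with rfl | hw0
  · simp
  · have hs0 : (s : ℂ) ≠ 0 := Complex.ofReal_ne_zero.2 hs.1.ne'
    simp only [hh]
    field_simp

theorem expConvex_alexander {G h : ℂ → ℂ} (hG : DifferentiableOn ℂ G (ball 0 2))
    (hb : ∀ z ∈ ball (0 : ℂ) 2, ‖G z - 1‖ ≤ 1 / 9) (hG0 : G 0 = 1) (hh : ∀ z, h z = z * G z) :
    ExpConvex (alexander h) := by
  have hder : ∀ z ∈ ball (0 : ℂ) 2, HasDerivAt (alexander h) (G z) z := fun z hz =>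
    hasDerivAt_alexander hG hh hz
  have hderiv : ∀ z ∈ unitDisk, deriv (alexander h) z = G z := fun z hz =>
    (hder z (unitDisk_subset_ball_two hz)).deriv
  have hderiv2 : ∀ z ∈ unitDisk, deriv (deriv (alexander h)) z = deriv G z := fun z hz =>
    Filter.EventuallyEq.deriv_eq (Filter.eventually_of_mem (isOpen_ball.mem_nhds hz) hderiv)
  have hdiff : DifferentiableOn ℂ (alexander h) (ball 0 2) := fun z hz =>
    (hder z hz).differentiableAt.differentiableWithinAt
  refine ⟨⟨(hdiff.analyticOnNhd isOpen_ball).mono unitDisk_subset_ball_two, by simp [alexander], ?_⟩,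
    fun z hz => ?_, (classPe_logDeriv hG hb).congr fun z hz => ?_⟩
  · rw [hderiv 0 (mem_ball_self one_pos), hG0]
  · rw [hderiv z hz]
    exact (ne_zero_of_norm_sub_one_le (hb z (unitDisk_subset_ball_two hz))).2
  · rw [hderiv z hz, hderiv2 z hz]

theorem pow_le_norm_pochhammer_mul {x y m : ℝ} (hx : 0 < x) (hy : 0 < y) (hm : 0 ≤ m)
    (hxy : m ≤ x * y) (n : ℕ) : m ^ n ≤ ‖pochhammer (x : ℂ) n * pochhammer (y : ℂ) n‖ := by
  induction n with
  | zero => simp [pochhammer]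
  | succ n ih =>
    have hfac : ∀ t : ℝ, 0 < t → ‖(t : ℂ) + n‖ = t + n := fun t ht => by
      rw [← Complex.ofReal_natCast, ← Complex.ofReal_add, Complex.norm_real,
        Real.norm_of_nonneg (by positivity)]
    have hsplit : pochhammer (x : ℂ) (n + 1) * pochhammer (y : ℂ) (n + 1) =
        pochhammer (x : ℂ) n * pochhammer (y : ℂ) n * (((x : ℂ) + n) * ((y : ℂ) + n)) := by
      simp only [pochhammer, ascPochhammer_succ_eval]
      ring
    rw [hsplit, norm_mul, norm_mul ((x : ℂ) + n), hfac x hx, hfac y hy, pow_succ]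
    have hn : (0 : ℝ) ≤ n := n.cast_nonneg
    gcongr
    nlinarith [mul_nonneg hx.le hn, mul_nonneg hy.le hn, mul_nonneg hn hn]

theorem norm_hyp1F2_term_le {x y : ℝ} (hx : 0 < x) (hy : 0 < y) (hxy : 5 ≤ x * y) {z : ℂ}
    (hz : z ∈ ball (0 : ℂ) 2) (n : ℕ) :
    ‖pochhammer 1 n / (pochhammer (x : ℂ) n * pochhammer (y : ℂ) n) *
      ((-z / 4) ^ n / (n.factorial : ℂ))‖ ≤ (1 / 10) ^ n := by
  have hden := pow_le_norm_pochhammer_mul hx hy (by norm_num) hxy n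
  have hfact : ‖(n.factorial : ℂ)‖ ≠ 0 := by simp [n.factorial_ne_zero]
  have hz2 : ‖-z / 4‖ ≤ 1 / 2 := by
    rw [mem_ball_zero_iff] at hz
    rw [norm_div, norm_neg, Complex.norm_ofNat]
    linarith
  have hone : pochhammer 1 n = (n.factorial : ℂ) := by
    rw [pochhammer, ascPochhammer_eval_one]
  rw [hone, norm_mul, norm_div, norm_div, norm_pow, div_mul_div_comm,
    mul_comm ‖(n.factorial : ℂ)‖ (_ ^ n), mul_div_mul_right _ _ hfact]
  calc ‖-z / 4‖ ^ n / ‖pochhammer (x : ℂ) n * pochhammer (y : ℂ) n‖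
      ≤ (1 / 2) ^ n / 5 ^ n := by gcongr
    _ = (1 / 10) ^ n := by rw [← div_pow]; norm_num

theorem differentiableOn_hyp1F2 {x y : ℝ} (hx : 0 < x) (hy : 0 < y) (hxy : 5 ≤ x * y) :
    DifferentiableOn ℂ (fun z => hyp1F2 1 x y (-z / 4)) (ball 0 2) :=
  Complex.differentiableOn_tsum_of_summable_norm
    (summable_geometric_of_lt_one (by norm_num) (by norm_num : (1 / 10 : ℝ) < 1))
    (fun n => by fun_prop) isOpen_ball fun n _ hz => norm_hyp1F2_term_le hx hy hxy hz n

theorem norm_hyp1F2_sub_one_le {x y : ℝ} (hx : 0 < x) (hy : 0 < y) (hxy : 5 ≤ x * y) {z : ℂ}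
    (hz : z ∈ ball (0 : ℂ) 2) : ‖hyp1F2 1 x y (-z / 4) - 1‖ ≤ 1 / 9 := by
  have hbound := norm_hyp1F2_term_le hx hy hxy hz
  have hgeom := hasSum_geometric_of_lt_one (by norm_num) (by norm_num : (1 / 10 : ℝ) < 1)
  have hsum := Summable.of_norm_bounded hgeom.summable hbound
  have hsplit := hsum.tsum_eq_zero_add
  have hzero : pochhammer 1 0 / (pochhammer (x : ℂ) 0 * pochhammer (y : ℂ) 0) *
      ((-z / 4) ^ 0 / (Nat.factorial 0 : ℂ)) = 1 := by simp [pochhammer]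
  rw [hzero] at hsplit
  rw [hyp1F2, hsplit, add_sub_cancel_left]
  refine tsum_of_norm_bounded (g := fun n : ℕ => (1 / 10 : ℝ) * (1 / 10) ^ n) ?_ fun n => ?_
  · have := hgeom.mul_left (1 / 10)
    rwa [show (1 / 10 : ℝ) * (1 - 1 / 10)⁻¹ = 1 / 9 by norm_num] at this
  · rw [← pow_succ']
    exact hbound (n + 1)

theorem hyp1F2_zero (a b c : ℂ) : hyp1F2 a b c 0 = 1 := by
  rw [hyp1F2, tsum_eq_single 0 fun n hn => by simp [hn]]
  simp [pochhammer]

theorem cpow_half_cpow (z a : ℂ) : (z ^ (1 / 2 : ℂ)) ^ a = z ^ (a / 2) := by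
  have him : (Complex.log z * (1 / 2 : ℂ)).im = z.arg / 2 := by
    rw [show (1 / 2 : ℂ) = ((1 / 2 : ℝ) : ℂ) by norm_num, Complex.im_mul_ofReal, Complex.log_im]
    ring
  rw [← Complex.cpow_mul, one_div_mul_eq_div]
  · rw [him]
    linarith [Complex.neg_pi_lt_arg z, Real.pi_pos]
  · rw [him]
    linarith [Complex.arg_le_pi z, Real.pi_pos]

theorem lommelH_eq {μ ν : ℂ} (h₁ : μ - ν + 1 ≠ 0) (h₂ : μ + ν + 1 ≠ 0) (hμ : μ + 1 ≠ 0) (z : ℂ) :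
    lommelH μ ν z = z * hyp1F2 1 ((μ - ν + 3) / 2) ((μ + ν + 3) / 2) (-z / 4) := by
  rcases eq_or_ne z 0 with rfl | hz
  · simp [lommelH, lommelS, hμ]
  · have hsq : (z ^ (1 / 2 : ℂ)) ^ 2 = z := by
      rw [one_div]
      exact Complex.cpow_ofNat_inv_pow z 2
    have hpow : z ^ ((1 - μ) / 2) * z ^ ((μ + 1) / 2) = z := by
      rw [← Complex.cpow_add _ _ hz, show (1 - μ) / 2 + (μ + 1) / 2 = 1 by ring, Complex.cpow_one]
    rw [lommelH, lommelS, cpow_half_cpow, hsq]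
    calc _ = z ^ ((1 - μ) / 2) * z ^ ((μ + 1) / 2) *
          hyp1F2 1 ((μ - ν + 3) / 2) ((μ + ν + 3) / 2) (-z / 4) := by field_simp
      _ = _ := by rw [hpow]

/-- The second hypothesis of the main theorem keeps `ν ^ 2` close to `(μ - 1) ^ 2`. -/
theorem parameter_bounds {μ ν : ℝ}
    (h : μ * (2 * Real.exp 1 - 1)
        - 1 / 4 * Real.exp 1 * (Real.exp 1 - 1) * |(μ - 1) ^ 2 - ν ^ 2|
      ≥ Real.exp 1 ^ 3 - Real.exp 1 ^ 2 + 13 * Real.exp 1 / 4 - 4) :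
    0 < μ ∧ |ν| < μ + 1 ∧ 20 ≤ (μ + 3) ^ 2 - ν ^ 2 := by
  have he₁ := Real.exp_one_gt_d9
  have he₂ := Real.exp_one_lt_d9
  set e := Real.exp 1
  set A := |(μ - 1) ^ 2 - ν ^ 2| with hA
  have hA0 : 0 ≤ A := abs_nonneg _
  have hrhs : 17 ≤ e ^ 3 - e ^ 2 + 13 * e / 4 - 4 := by
    have h2 : 7.38 ≤ e ^ 2 := by nlinarith
    have h3 : 1.718 * 7.38 ≤ (e - 1) * e ^ 2 := by gcongr <;> linarith
    nlinarith
  have hcoef : 1.16 ≤ 1 / 4 * e * (e - 1) := by nlinarith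
  have hprod : 1.16 * A ≤ 1 / 4 * e * (e - 1) * A := by gcongr
  have hμ : 0 < μ := by
    by_contra! hneg
    nlinarith
  have hlin : 1.16 * A ≤ 4.44 * μ - 17 := by nlinarith
  obtain ⟨hlo, hhi⟩ := abs_le.1 hA.ge
  refine ⟨hμ, abs_lt_of_sq_lt_sq (by nlinarith) (by linarith), by nlinarith⟩

end LommelExp

theorem theorem3p2 (μ ν : ℝ)
    (hadd : ∀ k : ℕ, μ + ν ≠ -(2 * (k : ℝ) + 1))
    (hsub : ∀ k : ℕ, μ - ν ≠ -(2 * (k : ℝ) + 1))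
    (h₁ : (μ + 1) * ((μ + 1) * (μ + 3) - ν ^ 2) ≥ 1 / 8)
    (h₂ : μ * (2 * Real.exp 1 - 1)
        - 1 / 4 * Real.exp 1 * (Real.exp 1 - 1) * |(μ - 1) ^ 2 - ν ^ 2|
      ≥ Real.exp 1 ^ 3 - Real.exp 1 ^ 2 + 13 * Real.exp 1 / 4 - 4) :
    LommelExp.ExpConvex (LommelExp.alexander (LommelExp.lommelH μ ν)) ∧
      LommelExp.ExpStarlike (LommelExp.lommelH μ ν) := by
  obtain ⟨hμ, hν, hlarge⟩ := LommelExp.parameter_bounds h₂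
  obtain ⟨hν₁, hν₂⟩ := abs_lt.1 hν
  have hx : 0 < (μ - ν + 3) / 2 := by linarith
  have hy : 0 < (μ + ν + 3) / 2 := by linarith
  have hxy : 5 ≤ (μ - ν + 3) / 2 * ((μ + ν + 3) / 2) := by nlinarith
  have hh : ∀ z, LommelExp.lommelH μ ν z = z * LommelExp.hyp1F2 1 ((μ - ν + 3) / 2 : ℝ)
      ((μ + ν + 3) / 2 : ℝ) (-z / 4) := fun z => by
    push_cast
    apply LommelExp.lommelH_eq
    · exact_mod_cast (by linarith : μ - ν + 1 ≠ 0)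
    · exact_mod_cast (by linarith : μ + ν + 1 ≠ 0)
    · exact_mod_cast (by linarith : μ + 1 ≠ 0)
  have hd := LommelExp.differentiableOn_hyp1F2 hx hy hxy
  have hb := fun z hz => LommelExp.norm_hyp1F2_sub_one_le hx hy hxy (z := z) hz
  have h0 : LommelExp.hyp1F2 1 ((μ - ν + 3) / 2 : ℝ) ((μ + ν + 3) / 2 : ℝ) (-0 / 4) = 1 := by
    rw [neg_zero, zero_div, LommelExp.hyp1F2_zero]
  exact ⟨LommelExp.expConvex_alexander hd hb h0 hh, LommelExp.expStarlike_of_eq_mul hd hb h0 hh⟩
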